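/- For complex $a,b,c,d,e$ write $${}_3F_2(a,b,c;d,e\mid 1)=\sum_{k\ge 0}\frac{(a)_k(b)_k(c)_k}{(d)_k(e)_k\,k!},\qquad s=d+e-a-b-c$$ ($s$ is the excess). If $\operatorname{Re} s>0$, or if an upper parameter is one of $0,-1,-2,\dots$ (so that the series terminates), ${}_3F_2(a,b,c;d,e\mid 1)$ denotes the sum of this series. In all other cases it denotes the value of its analytic continuation in the parameters (for instance in $d$), which is regular where none of $d,e,s$ is one of $0,-1,-2,\dots$. Throughout, $a,b,c$ are complex numbers and $n$ is a positive integer. No lower parameter is one of $0,-1,-2,\dots$, except that in (3), which is a finite sum, it is only required that neither lower parameter is one of $0,-1,\dots,-(n-2)$. In (4), (5) and (6) the excess is not one of $0,-1,-2,\dots$ unless the series terminates. Then: (1) If $a,b\notin\{1,2,3\}$ and $2+c-a-b\notin\{0,-1,-2,\dots\}$, then, with $D=(a-1)(a-2)(a-3)(b-1)(b-2)(b-3)$, $${}_3F_2(a,2,b;c,4\mid1)=-\frac{6\,(2c-5+a+b-ab)\,\Gamma(c)\,\Gamma(2+c-a-b)}{D\,\Gamma(c-a)\,\Gamma(c-b)}+\frac{6(c-1)(c-2)(ab-3a-3b+3+2c)}{D}.$$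 (2) If $c-a,\,c-b\notin\{1,2,3\}$, then, with $E=(c-a-1)(c-a-2)(c-a-3)(c-b-1)(c-b-2)(c-b-3)$, $${}_3F_2(a,2,b;c,4+a-c+b\mid1)=\frac{(c-a-b-2)(c-a-b-3)(c-1)(c-2)(3-4c-ac+c^2+3a+ab+3b-bc)}{E}+\frac{(a+5-ac+c^2-4c+ab-bc+b)\,\Gamma(4+a-c+b)\,\Gamma(c)}{E\,\Gamma(a)\,\Gamma(b)}.$$ (3) If $b\ne2$, $1+a-b\ne0$ and $b+n-2\neq0$, then $${}_3F_2\Bigl(2,a,1-n;\,b,\,2+\tfrac{n(1-a)}{b-2}\Bigm|1\Bigr)=\frac{(an-b-n+2)(b-1)}{(1+a-b)(b+n-2)}.$$ (4) If $a+n-1\neq0$ and $n-b+a\ne0$, then $${}_3F_2\Bigl(a,2,b;\,1+\tfrac{b(a-1)+n}{a+n-1},\,1+a+n\Bigm|1\Bigr)=\frac{(n+ab-b)(a+n)}{(n-b+a)\,n}.$$ (5) If $b\ne2$, $1+a-b\ne0$ and $n+2-b\ne0$, then $${}_3F_2\Bigl(2,a,n+1;\,b,\,2+\tfrac{n(a-1)}{b-2}\Bigm|1\Bigr)=\frac{(an+b-2-n)(b-1)}{(1+a-b)(n+2-b)};$$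 moreover, if $\sin\bigl(\pi\tfrac{(n+2-b)(1+a-b)}{b-2}\bigr)\ne0$, then the same ${}_3F_2$ also equals $$-\frac{(-1)^n\sin\bigl(\pi(b-a+\tfrac{n(a-1)}{b-2})\bigr)\,(an+b-2-n)(b-1)}{(1+a-b)(n+2-b)\sin\bigl(\pi\tfrac{(n+2-b)(1+a-b)}{b-2}\bigr)}.$$ (6) If $a-n-1\ne0$ and $b-a+n\neq0$, then $${}_3F_2\Bigl(a,2,b;\,2+\tfrac{(b-1)(a-1)}{a-n-1},\,a-n+1\Bigm|1\Bigr)=\frac{(n-a)(n-ab+b)}{(b-a+n)\,n}.$$ -/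

import Mathlib

/-- `z` is not one of the integers `0, -1, -2, …`. -/
def NotNonposInt (z : ℂ) : Prop := ∀ m : ℕ, z ≠ -(m : ℂ)

/-- The rising factorial `(a)_k = a (a + 1) ⋯ (a + k - 1)`. -/
noncomputable def rising (a : ℂ) (k : ℕ) : ℂ := (ascPochhammer ℂ k).eval a

/-- The `k`-th term of the series `₃F₂(a, b, c; d, e | 1)`. -/
noncomputable def term3F2 (a b c d e : ℂ) (k : ℕ) : ℂ :=
  rising a k * rising b k * rising c k / (rising d k * rising e k * (k.factorial : ℂ))

/-- The parametric excess of `₃F₂(a, b, c; d, e | 1)`. -/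
def excess3F2 (a b c d e : ℂ) : ℂ := d + e - (a + b + c)

/-- An upper parameter is one of `0, -1, -2, …`, so that the series is a finite sum. -/
def Terminates3F2 (a b c : ℂ) : Prop :=
  ∃ m : ℕ, a = -(m : ℂ) ∨ b = -(m : ℂ) ∨ c = -(m : ℂ)

/-- The (open and connected) complement of the poles of `d ↦ ₃F₂(a, b, c; d, e | 1)`: neither `d`
nor the excess is one of `0, -1, -2, …`. -/
def regular3F2 (a b c e : ℂ) : Set ℂ :=
  {d | NotNonposInt d ∧ NotNonposInt (excess3F2 a b c d e)}

/-- `g` is the analytic continuation of `d ↦ ₃F₂(a, b, c; d, e | 1)` from the half plane where the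
series converges (positive real part of the excess) to the complement of the poles. By the identity
theorem `g` is determined on `regular3F2 a b c e`. (Since `₃F₂(a, b, c; d, e | 1)` extends to a
meromorphic function of all five parameters jointly, continuing in any other parameter would give
the same values.) -/
def IsContinuation3F2 (a b c e : ℂ) (g : ℂ → ℂ) : Prop :=
  DifferentiableOn ℂ g (regular3F2 a b c e) ∧
    ∀ d ∈ regular3F2 a b c e, 0 < (excess3F2 a b c d e).re → HasSum (term3F2 a b c d e) (g d)

open Classical in
/-- `₃F₂(a, b, c; d, e | 1) = v`: when the excess has positive real part, or the series terminates,
the series has sum `v`; otherwise the analytic continuation exists, is regular at `d` and takes the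
value `v` there. -/
def Has3F2Value (a b c d e v : ℂ) : Prop :=
  if 0 < (excess3F2 a b c d e).re ∨ Terminates3F2 a b c then
    HasSum (term3F2 a b c d e) v
  else
    d ∈ regular3F2 a b c e ∧ ∃ g : ℂ → ℂ, IsContinuation3F2 a b c e g ∧ g d = v

/-- The parameters are admissible for `₃F₂(a, b, c; d, e | 1)`: no lower parameter is one of
`0, -1, -2, …`, and the excess is not one of them either unless the series terminates. -/
def Admissible3F2 (a b c d e : ℂ) : Prop :=
  NotNonposInt d ∧ NotNonposInt e ∧
    (Terminates3F2 a b c ∨ NotNonposInt (excess3F2 a b c d e))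

open Filter Topology Asymptotics

/-! Since `(2)_k / k! = k + 1`, the terms are `(k + 1) r_k`, where `r_k = (a)_k (b)_k / ((d)_k
(e)_k)`. Put `U_k = (d+k-1)(e+k-1) r_k` and `γ = (a-1)(b-1) - (d-2)(e-2)`. The ratio of consecutive
`r_k` gives `U_{k+1} - U_k = γ r_k - s (k+1) r_k`, with `s` the excess, so that `s · ₃F₂ =
(d-1)(e-1) + γ ∑ r_k` (`hasSum_term3F2_two`).

In (3)-(6) the lower parameters are chosen so that `γ = 0`, and the value is `(d-1)(e-1)/s`. Outside
convergence this needs a continuation of `∑ r_k` in `d`. It comes from a contiguous relation between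
`d` and `d + 1` (`ratioSum_recurrence`), iterated leftwards from a half plane
(`exists_continuation_ratioSum`).

In (1), with `e = 4`, the same relation has a solution that is a polynomial in `d`. The difference
from `∑ r_k` solves the homogeneous relation, and its growth as `d + N → ∞` fixes it as a multiple
of a Gamma quotient (`ratioSum_four`).

In (2) the excess is 2, and Gosper summation with a quadratic polynomial certificate succeeds. Its
boundary term at infinity, computed from Euler's limit, is the Gamma term
(`hasSum_term3F2_two_of_excess_two`). -/

/-! ### Rising factorials -/

theorem rising_zero (a : ℂ) : rising a 0 = 1 := by simp [rising]

theorem rising_succ (a : ℂ) (k : ℕ) : rising a (k + 1) = rising a k * (a + k) := by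
  simp [rising, ascPochhammer_succ_eval]

theorem rising_eq_prod (a : ℂ) (k : ℕ) : rising a k = ∏ j ∈ Finset.range k, (a + j) := by
  induction k with
  | zero => simp [rising_zero]
  | succ k ih => rw [rising_succ, Finset.prod_range_succ, ih]

theorem rising_add_one_mul (a : ℂ) (k : ℕ) : rising (a + 1) k * a = rising a k * (a + k) := by
  induction k with
  | zero => simp [rising_zero]
  | succ k ih =>
    rw [rising_succ, rising_succ]
    push_cast
    linear_combination (a + 1 + k) * ih

theorem rising_neg_eq_zero {m k : ℕ} (h : m < k) : rising (-(m : ℂ)) k = 0 := by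
  rw [rising_eq_prod]
  exact Finset.prod_eq_zero (Finset.mem_range.2 h) (by simp)

theorem rising_two (k : ℕ) : rising 2 k = (k + 1) * (k.factorial : ℂ) := by
  induction k with
  | zero => simp [rising_zero]
  | succ k ih =>
    rw [rising_succ, ih, Nat.factorial_succ]
    push_cast
    ring

theorem NotNonposInt.add_natCast_ne_zero {z : ℂ} (hz : NotNonposInt z) (k : ℕ) :
    z + k ≠ 0 := fun h => hz k (eq_neg_of_add_eq_zero_left h)

theorem NotNonposInt.ne_zero {z : ℂ} (hz : NotNonposInt z) : z ≠ 0 := by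
  simpa using hz.add_natCast_ne_zero 0

theorem NotNonposInt.add_one {z : ℂ} (hz : NotNonposInt z) : NotNonposInt (z + 1) := by
  intro m h
  refine hz (m + 1) ?_
  push_cast
  linear_combination h

theorem NotNonposInt.add_natCast {z : ℂ} (hz : NotNonposInt z) (k : ℕ) :
    NotNonposInt (z + k) := by
  intro m h
  refine hz (m + k) ?_
  push_cast
  linear_combination h

theorem NotNonposInt.of_re_pos {z : ℂ} (hz : 0 < z.re) : NotNonposInt z := by
  intro m h
  rw [h] at hz
  simp only [Complex.neg_re, Complex.natCast_re] at hz
  linarith [(Nat.cast_nonneg m : (0 : ℝ) ≤ m)]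

theorem NotNonposInt.rising_ne_zero {z : ℂ} (hz : NotNonposInt z) (k : ℕ) : rising z k ≠ 0 := by
  rw [rising_eq_prod]
  exact Finset.prod_ne_zero_iff.2 fun j _ => hz.add_natCast_ne_zero j

/-! ### Asymptotics and summability of the ratios -/

/-- Euler's limit for the reciprocal of the Gamma function, in terms of rising factorials. -/
theorem tendsto_rising_div (a : ℂ) :
    Tendsto (fun k : ℕ => rising a k / ((k : ℂ) ^ (a - 1) * (k.factorial : ℂ))) atTop
      (𝓝 (Complex.Gamma a)⁻¹) := by
  by_cases ha : NotNonposInt a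
  · have h1 := (Complex.GammaSeq_tendsto_Gamma a).inv₀ (Complex.Gamma_ne_zero ha)
    have h2 : Tendsto (fun k : ℕ => (k : ℂ) / (k + a)) atTop (𝓝 1) :=
      tendsto_natCast_div_add_atTop a
    have h3 := h1.mul h2
    rw [mul_one] at h3
    refine h3.congr' ?_
    filter_upwards [eventually_ne_atTop 0] with k hk
    have hk' : (k : ℂ) ≠ 0 := Nat.cast_ne_zero.2 hk
    have hak := ha.add_natCast_ne_zero k
    have hak' : (k : ℂ) + a ≠ 0 := by rwa [add_comm]
    have hp : (k : ℂ) ^ (a - 1) ≠ 0 := by simp [Complex.cpow_eq_zero_iff, hk]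
    have hp' : (k : ℂ) ^ a = (k : ℂ) ^ (a - 1) * k := by
      conv_lhs => rw [← sub_add_cancel a 1, Complex.cpow_add _ _ hk', Complex.cpow_one]
    have hf : (k.factorial : ℂ) ≠ 0 := Nat.cast_ne_zero.2 k.factorial_ne_zero
    rw [Complex.GammaSeq, ← rising_eq_prod, rising_succ, hp', inv_div]
    field_simp
    ring
  · obtain ⟨m, rfl⟩ : ∃ m : ℕ, a = -m := by simpa [NotNonposInt] using ha
    -- Mathlib sets `Γ = 0` at its poles, so the inverse is 0 there, the true value of the entire
    -- function `1/Γ`.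
    rw [Complex.Gamma_neg_nat_eq_zero, inv_zero]
    refine tendsto_const_nhds.congr' ?_
    filter_upwards [eventually_gt_atTop m] with k hk
    rw [rising_neg_eq_zero hk, zero_div]

/-- The ratio `(a)_k (b)_k / ((d)_k (e)_k)`. -/
noncomputable def risingRatio (a b d e : ℂ) (k : ℕ) : ℂ :=
  rising a k * rising b k / (rising d k * rising e k)

theorem term3F2_two (a b d e : ℂ) (k : ℕ) :
    term3F2 a 2 b d e k = (k + 1) * risingRatio a b d e k := by
  have hf : (k.factorial : ℂ) ≠ 0 := Nat.cast_ne_zero.2 k.factorial_ne_zero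
  rw [term3F2, risingRatio, rising_two, ← mul_div_assoc,
    ← mul_div_mul_right ((k + 1 : ℂ) * _) _ hf]
  congr 1
  ring

theorem risingRatio_zero (a b d e : ℂ) : risingRatio a b d e 0 = 1 := by
  simp [risingRatio, rising_zero]

theorem risingRatio_succ (a b d e : ℂ) (k : ℕ) :
    risingRatio a b d e (k + 1) =
      risingRatio a b d e k * ((a + k) * (b + k) / ((d + k) * (e + k))) := by
  simp only [risingRatio, rising_succ]
  rw [div_mul_div_comm]
  congr 1 <;> ring

theorem mul_risingRatio_succ (a b : ℂ) {d e : ℂ} {k : ℕ} (hd : d + k ≠ 0) (he : e + k ≠ 0) :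
    (d + k) * (e + k) * risingRatio a b d e (k + 1) =
      (a + k) * (b + k) * risingRatio a b d e k := by
  rw [risingRatio_succ]
  field_simp

theorem mul_risingRatio (a b e : ℂ) {d : ℂ} (hd : NotNonposInt d) (k : ℕ) :
    d * risingRatio a b d e k = (d + k) * risingRatio a b (d + 1) e k := by
  have h := rising_add_one_mul d k
  have h1 := hd.rising_ne_zero k
  have h2 := hd.add_one.rising_ne_zero k
  rw [risingRatio, risingRatio, ← mul_div_assoc, ← mul_div_assoc]
  rcases eq_or_ne (rising e k) 0 with he | he
  · simp [he]
  rw [div_eq_div_iff (mul_ne_zero h1 he) (mul_ne_zero h2 he)]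
  linear_combination rising a k * rising b k * rising e k * h

theorem tendsto_risingRatio (a b : ℂ) {d e : ℂ} (hd : NotNonposInt d) (he : NotNonposInt e) :
    Tendsto (fun k : ℕ => risingRatio a b d e k * (k : ℂ) ^ (d + e - a - b)) atTop
      (𝓝 (Complex.Gamma d * Complex.Gamma e / (Complex.Gamma a * Complex.Gamma b))) := by
  have h := ((tendsto_rising_div a).mul (tendsto_rising_div b)).div
    ((tendsto_rising_div d).mul (tendsto_rising_div e))
    (mul_ne_zero (inv_ne_zero (Complex.Gamma_ne_zero hd))
      (inv_ne_zero (Complex.Gamma_ne_zero he)))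
  have hL : (Complex.Gamma a)⁻¹ * (Complex.Gamma b)⁻¹ /
      ((Complex.Gamma d)⁻¹ * (Complex.Gamma e)⁻¹) =
      Complex.Gamma d * Complex.Gamma e / (Complex.Gamma a * Complex.Gamma b) := by
    rw [← mul_inv, ← mul_inv, div_inv_eq_mul, mul_comm, div_eq_mul_inv]
  rw [hL] at h
  refine h.congr' ?_
  filter_upwards [eventually_ne_atTop 0] with k hk
  have hk' : (k : ℂ) ≠ 0 := Nat.cast_ne_zero.2 hk
  have hp (z : ℂ) : (k : ℂ) ^ z ≠ 0 := by simp [Complex.cpow_eq_zero_iff, hk]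
  have hw : (k : ℂ) ^ (d + e - a - b) * ((k : ℂ) ^ (a - 1) * (k : ℂ) ^ (b - 1)) =
      (k : ℂ) ^ (d - 1) * (k : ℂ) ^ (e - 1) := by
    rw [← Complex.cpow_add _ _ hk', ← Complex.cpow_add _ _ hk', ← Complex.cpow_add _ _ hk']
    congr 1
    ring
  have hf : (k.factorial : ℂ) ≠ 0 := Nat.cast_ne_zero.2 k.factorial_ne_zero
  have hd' := hd.rising_ne_zero k
  have he' := he.rising_ne_zero k
  have ha1 := hp (a - 1)
  have hb1 := hp (b - 1)
  have hd1 := hp (d - 1)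
  have he1 := hp (e - 1)
  simp only [Pi.div_apply, risingRatio]
  rw [div_mul_div_comm, div_mul_div_comm, div_div_div_eq, div_mul_eq_mul_div,
    div_eq_div_iff (by positivity) (by positivity)]
  linear_combination -(rising a k * rising b k * rising d k * rising e k * k.factorial ^ 2) * hw

theorem isBigO_risingRatio (a b : ℂ) {d e : ℂ} (hd : NotNonposInt d) (he : NotNonposInt e) :
    (fun k : ℕ => risingRatio a b d e k) =O[atTop]
      fun k : ℕ => (k : ℝ) ^ (-(d + e - a - b).re) := by
  have h := (tendsto_risingRatio a b hd he).isBigO_one ℝ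
  have h2 : (fun k : ℕ => (k : ℂ) ^ (-(d + e - a - b))) =O[atTop]
      fun k : ℕ => (k : ℝ) ^ (-(d + e - a - b).re) := by
    refine IsBigO.of_bound 1 ?_
    filter_upwards [eventually_gt_atTop 0] with k hk
    rw [one_mul, Complex.norm_natCast_cpow_of_pos hk, Complex.neg_re]
    exact le_abs_self _
  refine IsBigO.congr' (h.mul h2) ?_ (Eventually.of_forall fun k => one_mul _)
  filter_upwards [eventually_ne_atTop 0] with k hk
  have hk' : (k : ℂ) ≠ 0 := Nat.cast_ne_zero.2 hk
  rw [mul_assoc, ← Complex.cpow_add _ _ hk', add_neg_cancel, Complex.cpow_zero, mul_one]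

/-- One of `a`, `b` is a nonpositive integer. -/
def IsFiniteRatio (a b : ℂ) : Prop := ∃ m : ℕ, a = -(m : ℂ) ∨ b = -(m : ℂ)

theorem risingRatio_eventually_eq_zero {a b : ℂ} (h : IsFiniteRatio a b) (d e : ℂ) :
    ∃ m : ℕ, ∀ k, m < k → risingRatio a b d e k = 0 := by
  obtain ⟨m, rfl | rfl⟩ := h <;> exact ⟨m, fun k hk => by simp [risingRatio, rising_neg_eq_zero hk]⟩

theorem isBigO_pow_mul_risingRatio (a b : ℂ) {d e : ℂ} (hd : NotNonposInt d)
    (he : NotNonposInt e) (j : ℕ) :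
    (fun k : ℕ => (k : ℂ) ^ j * risingRatio a b d e k) =O[atTop]
      fun k : ℕ => (k : ℝ) ^ (j - (d + e - a - b).re) := by
  have h : (fun k : ℕ => (k : ℂ) ^ j) =O[atTop] fun k : ℕ => (k : ℝ) ^ j :=
    IsBigO.of_bound 1 (Eventually.of_forall fun k => by simp)
  refine (h.mul (isBigO_risingRatio a b hd he)).congr' EventuallyEq.rfl ?_
  filter_upwards [eventually_gt_atTop 0] with k hk
  have hk' : (0 : ℝ) < k := Nat.cast_pos.2 hk
  rw [sub_eq_add_neg (j : ℝ), Real.rpow_add hk', Real.rpow_natCast]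

theorem tendsto_pow_mul_risingRatio {a b d e : ℂ} (hd : NotNonposInt d) (he : NotNonposInt e)
    (j : ℕ) (h : j < (d + e - a - b).re ∨ IsFiniteRatio a b) :
    Tendsto (fun k : ℕ => (k : ℂ) ^ j * risingRatio a b d e k) atTop (𝓝 0) := by
  rcases h with h | h
  · refine (isBigO_pow_mul_risingRatio a b hd he j).trans_tendsto ?_
    have := (tendsto_rpow_neg_atTop (sub_pos.2 h)).comp tendsto_natCast_atTop_atTop
    simpa [Function.comp_def] using this
  · obtain ⟨m, hm⟩ := risingRatio_eventually_eq_zero h d e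
    refine tendsto_const_nhds.congr' ?_
    filter_upwards [eventually_gt_atTop m] with k hk
    simp [hm k hk]

theorem summable_pow_mul_risingRatio {a b d e : ℂ} (hd : NotNonposInt d) (he : NotNonposInt e)
    (j : ℕ) (h : j + 1 < (d + e - a - b).re ∨ IsFiniteRatio a b) :
    Summable (fun k : ℕ => (k : ℂ) ^ j * risingRatio a b d e k) := by
  rcases h with h | h
  · exact summable_of_isBigO_nat (Real.summable_nat_rpow.2 (by linarith))
      (isBigO_pow_mul_risingRatio a b hd he j)
  · obtain ⟨m, hm⟩ := risingRatio_eventually_eq_zero h d e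
    refine summable_of_ne_finset_zero (s := Finset.range (m + 1)) fun k hk => ?_
    rw [hm k (by simpa using hk), mul_zero]

theorem summable_risingRatio {a b d e : ℂ} (hd : NotNonposInt d) (he : NotNonposInt e)
    (h : 1 < (d + e - a - b).re ∨ IsFiniteRatio a b) : Summable (risingRatio a b d e) := by
  simpa using summable_pow_mul_risingRatio hd he 0 (by simpa using h)

theorem Summable.hasSum_of_telescoping {f U : ℕ → ℂ} {L : ℂ} (hf : Summable f)
    (h : ∀ k, U (k + 1) - U k = f k) (hU : Tendsto U atTop (𝓝 L)) : HasSum f (L - U 0) := by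
  have h1 := hf.hasSum.tendsto_sum_nat
  have h2 : Tendsto (fun n => ∑ i ∈ Finset.range n, f i) atTop (𝓝 (L - U 0)) := by
    simp_rw [← h, Finset.sum_range_sub]
    exact hU.sub_const _
  rw [← tendsto_nhds_unique h1 h2]
  exact hf.hasSum

/-! ### Contiguous relation and reduction of the series to `ratioSum` -/

/-- The sum of the series with terms `(a)_k (b)_k / ((d)_k (e)_k)`, as a function of `d`. -/
noncomputable def ratioSum (a b e d : ℂ) : ℂ := ∑' k, risingRatio a b d e k

theorem IsFiniteRatio.or_re_add_one {a b d e : ℂ} {x : ℝ}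
    (h : x < (d + e - a - b).re ∨ IsFiniteRatio a b) :
    x < (d + 1 + e - a - b).re ∨ IsFiniteRatio a b := by
  refine h.imp_left fun h => ?_
  simp only [Complex.add_re, Complex.sub_re, Complex.one_re] at h ⊢
  linarith

theorem tendsto_linear_mul_risingRatio {a b d e : ℂ} (hd : NotNonposInt d) (he : NotNonposInt e)
    (h : 1 < (d + e - a - b).re ∨ IsFiniteRatio a b) :
    Tendsto (fun k : ℕ => d * (e + k - 1) * risingRatio a b d e k) atTop (𝓝 0) := by
  have h0 := tendsto_pow_mul_risingRatio hd he 0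
    (h.imp_left fun h => by push_cast; linarith)
  have h1 := tendsto_pow_mul_risingRatio hd he 1 (by simpa using h)
  have := (h1.const_mul d).add (h0.const_mul (d * (e - 1)))
  simp only [mul_zero, add_zero] at this
  refine this.congr fun k => ?_
  ring

/-- Creative telescoping: the combination of the `k`-th terms at `d` and `d + 1` is the difference
of `U_k = d (e+k-1) r_k`. Here `U_0 = d (e-1)` is the inhomogeneous term, and `U_k → 0`. -/
theorem ratioSum_recurrence {a b d e : ℂ} (hd : NotNonposInt d) (he : NotNonposInt e)
    (h : 1 < (d + e - a - b).re ∨ IsFiniteRatio a b) :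
    d * (d + e - a - b - 1) * ratioSum a b e d =
      d * (e - 1) + (d - a) * (d - b) * ratioSum a b e (d + 1) := by
  have s0 := summable_risingRatio hd he h
  have s1 := summable_risingRatio hd.add_one he (IsFiniteRatio.or_re_add_one h)
  have hs := (s1.hasSum.mul_left ((d - a) * (d - b))).sub
    (s0.hasSum.mul_left (d * (d + e - a - b - 1)))
  have ht := hs.summable.hasSum_of_telescoping
    (U := fun k : ℕ => d * (e + k - 1) * risingRatio a b d e k) (L := 0) (fun k => ?_)
    (tendsto_linear_mul_risingRatio hd he h)
  · have := hs.unique ht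
    simp only [risingRatio_zero, Nat.cast_zero] at this
    simp only [ratioSum]
    linear_combination -this
  · have h1 := mul_risingRatio_succ a b (hd.add_natCast_ne_zero k) (he.add_natCast_ne_zero k)
    have h2 := mul_risingRatio a b e hd k
    have h3 := hd.add_natCast_ne_zero k
    have h4 : d * ((e + k) * risingRatio a b d e (k + 1)) =
        (a + k) * (b + k) * risingRatio a b (d + 1) e k := by
      apply mul_left_cancel₀ h3
      linear_combination d * h1 + (a + k) * (b + k) * h2
    push_cast
    linear_combination h4 + (d + e - a - b - 1 - (e + k - 1)) * h2

theorem hasSum_term3F2_two {a b d e : ℂ} (hd : NotNonposInt d) (he : NotNonposInt e)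
    (h : 0 < (excess3F2 a 2 b d e).re ∨ IsFiniteRatio a b) (hs : excess3F2 a 2 b d e ≠ 0) :
    HasSum (term3F2 a 2 b d e)
      (((d - 1) * (e - 1) + ((a - 1) * (b - 1) - (d - 2) * (e - 2)) * ratioSum a b e d) /
        excess3F2 a 2 b d e) := by
  -- The ratios decay like `k ^ -(s + 2)`, which is just enough for the boundary term, quadratic in
  -- `k` times the ratio, to vanish.
  have h' : 2 < (d + e - a - b).re ∨ IsFiniteRatio a b := by
    refine h.imp_left fun h => ?_
    simp only [excess3F2, Complex.add_re, Complex.sub_re, Complex.re_ofNat] at h ⊢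
    linarith
  have s0 := summable_risingRatio hd he (h'.imp_left fun h => by linarith)
  have s1 := summable_pow_mul_risingRatio hd he 1 (h'.imp_left fun h => by push_cast; linarith)
  have t0 := tendsto_pow_mul_risingRatio hd he 0 (h'.imp_left fun h => by push_cast; linarith)
  have t1 := tendsto_pow_mul_risingRatio hd he 1 (h'.imp_left fun h => by push_cast; linarith)
  have t2 := tendsto_pow_mul_risingRatio hd he 2 (h'.imp_left fun h => by push_cast; linarith)
  have hU : Tendsto (fun k : ℕ => (d + k - 1) * (e + k - 1) * risingRatio a b d e k) atTop
      (𝓝 0) := by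
    have := (t2.add (t1.const_mul (d + e - 2))).add (t0.const_mul ((d - 1) * (e - 1)))
    simp only [mul_zero, add_zero] at this
    refine this.congr fun k => ?_
    ring
  have hsum : Summable (term3F2 a 2 b d e) := by
    refine (s1.add s0).congr fun k => ?_
    rw [term3F2_two]
    ring
  have hc := (s0.hasSum.mul_left ((a - 1) * (b - 1) - (d - 2) * (e - 2))).sub
    (hsum.hasSum.mul_left (excess3F2 a 2 b d e))
  have ht := hc.summable.hasSum_of_telescoping (fun k => ?_) hU
  · have := hc.unique ht
    simp only [risingRatio_zero, Nat.cast_zero] at this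
    have hv : ((d - 1) * (e - 1) + ((a - 1) * (b - 1) - (d - 2) * (e - 2)) * ratioSum a b e d) /
        excess3F2 a 2 b d e = ∑' k, term3F2 a 2 b d e k := by
      rw [div_eq_iff hs, ratioSum]
      linear_combination this
    rw [hv]
    exact hsum.hasSum
  · have h1 := mul_risingRatio_succ a b (hd.add_natCast_ne_zero k) (he.add_natCast_ne_zero k)
    rw [term3F2_two, excess3F2]
    push_cast
    linear_combination h1

/-! ### Analytic continuation in `d` -/

/-- Each factor satisfies `|d + j| ≥ Re d + j ≥ r + j`. This is the Weierstrass majorant on a half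
plane, used for analyticity and for boundedness. -/
theorem norm_risingRatio_le (a b e : ℂ) {r : ℝ} (hr : 0 < r) {d : ℂ} (hd : r ≤ d.re) (k : ℕ) :
    ‖risingRatio a b d e k‖ ≤ ‖risingRatio a b r e k‖ := by
  have hle : ‖rising r k‖ ≤ ‖rising d k‖ := by
    simp only [rising_eq_prod, norm_prod]
    refine Finset.prod_le_prod (fun _ _ => norm_nonneg _) fun j _ => ?_
    have : ‖(r : ℂ) + j‖ = r + j := by
      rw [← Complex.ofReal_natCast, ← Complex.ofReal_add, Complex.norm_real,
        Real.norm_of_nonneg (by positivity)]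
    rw [this]
    refine le_trans ?_ (Complex.re_le_norm _)
    simp only [Complex.add_re, Complex.natCast_re]
    linarith
  have hpos : 0 < ‖rising r k‖ :=
    norm_pos_iff.2 ((NotNonposInt.of_re_pos (by simpa using hr)).rising_ne_zero k)
  simp only [risingRatio, norm_div, norm_mul]
  rcases (norm_nonneg (rising e k)).eq_or_lt with he | he
  · simp [← he]
  · gcongr

/-- An abscissa to the right of which the series `ratioSum a b e` converges uniformly. -/
theorem exists_summable_abscissa (a b e : ℂ) :
    ∃ r : ℝ, 0 < r ∧ ∀ d : ℂ, r ≤ d.re → 1 < (d + e - a - b).re := by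
  refine ⟨2 + |(e - a - b).re|, by positivity, fun d hd => ?_⟩
  have := neg_abs_le (e - a - b).re
  simp only [Complex.add_re, Complex.sub_re] at *
  linarith

theorem summable_norm_risingRatio {a b e : ℂ} (he : NotNonposInt e) {r : ℝ} (hr : 0 < r)
    (h : ∀ d : ℂ, r ≤ d.re → 1 < (d + e - a - b).re) :
    Summable fun k => ‖risingRatio a b r e k‖ :=
  (summable_risingRatio (NotNonposInt.of_re_pos (by simpa using hr)) he
    (Or.inl (h r (by simp)))).norm

theorem differentiable_rising (k : ℕ) : Differentiable ℂ fun a => rising a k :=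
  (ascPochhammer ℂ k).differentiable

theorem differentiableOn_ratioSum {a b e : ℂ} (he : NotNonposInt e) {r : ℝ} (hr : 0 < r)
    (h : ∀ d : ℂ, r ≤ d.re → 1 < (d + e - a - b).re) :
    DifferentiableOn ℂ (ratioSum a b e) {d | r < d.re} := by
  refine Complex.differentiableOn_tsum_of_summable_norm (summable_norm_risingRatio he hr h)
    (fun k d hd => ?_) (isOpen_lt continuous_const Complex.continuous_re)
    fun k d hd => norm_risingRatio_le a b e hr (le_of_lt hd) k
  have hd0 : NotNonposInt d := NotNonposInt.of_re_pos (hr.trans hd)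
  exact (((differentiableAt_const _).div ((differentiable_rising k d).mul_const _)
    (mul_ne_zero (hd0.rising_ne_zero k) (he.rising_ne_zero k)))).differentiableWithinAt

/-- The set on which the analytic continuation of `ratioSum a b e` is regular. -/
def ratioSumRegular (a b e : ℂ) : Set ℂ :=
  {d | NotNonposInt d ∧ NotNonposInt (d + e - a - b - 1)}

theorem add_one_mem_ratioSumRegular {a b e d : ℂ} (hd : d ∈ ratioSumRegular a b e) :
    d + 1 ∈ ratioSumRegular a b e := by
  refine ⟨hd.1.add_one, ?_⟩
  have := hd.2.add_one
  ring_nf at this ⊢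
  exact this

theorem mem_ratioSumRegular {a b e d : ℂ} (hd : d ∈ regular3F2 a 2 b e) :
    d ∈ ratioSumRegular a b e := by
  refine ⟨hd.1, ?_⟩
  have := hd.2.add_one
  rw [excess3F2] at this
  ring_nf at this ⊢
  exact this

/-- The operator expressing `ratioSum a b e d` by the value at `d + 1`. -/
noncomputable def raiseStep (a b e : ℂ) (f : ℂ → ℂ) (d : ℂ) : ℂ :=
  (d * (e - 1) + (d - a) * (d - b) * f (d + 1)) / (d * (d + e - a - b - 1))

/-- The continuation of `ratioSum a b e` by `N` steps to the left. -/
noncomputable def ratioSumIter (a b e : ℂ) (N : ℕ) : ℂ → ℂ :=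
  (raiseStep a b e)^[N] (ratioSum a b e)

theorem ratioSumIter_succ (a b e : ℂ) (N : ℕ) :
    ratioSumIter a b e (N + 1) = raiseStep a b e (ratioSumIter a b e N) :=
  Function.iterate_succ_apply' _ _ _

theorem raiseStep_ratioSum {a b e d : ℂ} (he : NotNonposInt e) (hd : d ∈ ratioSumRegular a b e)
    (h : 1 < (d + e - a - b).re) : raiseStep a b e (ratioSum a b e) d = ratioSum a b e d := by
  rw [raiseStep, div_eq_iff (mul_ne_zero hd.1.ne_zero hd.2.ne_zero)]
  linear_combination -ratioSum_recurrence hd.1 he (Or.inl h)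

theorem ratioSumIter_eq_ratioSum {a b e : ℂ} (he : NotNonposInt e) (N : ℕ) {d : ℂ}
    (hd : d ∈ ratioSumRegular a b e) (h : 1 < (d + e - a - b).re) :
    ratioSumIter a b e N d = ratioSum a b e d := by
  induction N generalizing d with
  | zero => rfl
  | succ N ih =>
    rw [ratioSumIter_succ, ← raiseStep_ratioSum he hd h, raiseStep, raiseStep,
      ih (add_one_mem_ratioSumRegular hd)]
    simp only [Complex.add_re, Complex.sub_re, Complex.one_re] at h ⊢
    linarith

/-- After `N` shifts the argument lies in the half plane where the series obeys the recurrence, so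
one more step changes nothing. -/
theorem ratioSumIter_succ_eq {a b e : ℂ} (he : NotNonposInt e) {r : ℝ}
    (h : ∀ d : ℂ, r ≤ d.re → 1 < (d + e - a - b).re) (N : ℕ) {d : ℂ}
    (hd : d ∈ ratioSumRegular a b e) (hdr : r < d.re + N) :
    ratioSumIter a b e (N + 1) d = ratioSumIter a b e N d := by
  induction N generalizing d with
  | zero => exact raiseStep_ratioSum he hd (h d (by simpa using hdr.le))
  | succ N ih =>
    rw [ratioSumIter_succ a b e (N + 1), raiseStep, ih (add_one_mem_ratioSumRegular hd),
      ratioSumIter_succ a b e N, raiseStep]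
    simp only [Complex.add_re, Complex.one_re]
    push_cast at hdr
    linarith

theorem ratioSumIter_eq_of_le {a b e : ℂ} (he : NotNonposInt e) {r : ℝ}
    (h : ∀ d : ℂ, r ≤ d.re → 1 < (d + e - a - b).re) {N M : ℕ} (hNM : N ≤ M) {d : ℂ}
    (hd : d ∈ ratioSumRegular a b e) (hdr : r < d.re + N) :
    ratioSumIter a b e M d = ratioSumIter a b e N d := by
  induction M, hNM using Nat.le_induction with
  | base => rfl
  | succ M hM ih =>
    have : (N : ℝ) ≤ M := Nat.cast_le.2 hM
    rw [ratioSumIter_succ_eq he h M hd (by linarith), ih]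

theorem differentiableOn_ratioSumIter {a b e : ℂ} (he : NotNonposInt e) {r : ℝ} (hr : 0 < r)
    (h : ∀ d : ℂ, r ≤ d.re → 1 < (d + e - a - b).re) (N : ℕ) :
    DifferentiableOn ℂ (ratioSumIter a b e N)
      (ratioSumRegular a b e ∩ {d | r < d.re + N}) := by
  induction N with
  | zero =>
    refine (differentiableOn_ratioSum he hr h).mono fun d hd => ?_
    simpa using hd.2
  | succ N ih =>
    rw [ratioSumIter_succ]
    have h1 : DifferentiableOn ℂ (fun d => ratioSumIter a b e N (d + 1))
        (ratioSumRegular a b e ∩ {d | r < d.re + (N + 1 : ℕ)}) := by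
      refine ih.comp (by fun_prop) fun d hd => ⟨add_one_mem_ratioSumRegular hd.1, ?_⟩
      have := hd.2
      simp only [Set.mem_ofPred_eq, Complex.add_re, Complex.one_re] at this ⊢
      push_cast at this
      linarith
    refine DifferentiableOn.div (by fun_prop) (by fun_prop) fun d hd => ?_
    exact mul_ne_zero hd.1.1.ne_zero hd.1.2.ne_zero

theorem exists_continuation_ratioSum (a b : ℂ) {e : ℂ} (he : NotNonposInt e) :
    ∃ G : ℂ → ℂ, DifferentiableOn ℂ G (ratioSumRegular a b e) ∧
      ∀ d ∈ ratioSumRegular a b e, 1 < (d + e - a - b).re → G d = ratioSum a b e d := by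
  obtain ⟨r, hr, h⟩ := exists_summable_abscissa a b e
  have hN (d : ℂ) : r < d.re + (⌊r - d.re⌋₊ + 1 : ℕ) := by
    have := Nat.lt_floor_add_one (r - d.re)
    push_cast
    linarith
  -- The number of steps depends on `d` and jumps, but near each point all sufficiently long
  -- iterates agree, so locally the function is a single iterate.
  refine ⟨fun d => ratioSumIter a b e (⌊r - d.re⌋₊ + 1) d, fun d hd => ?_, fun d hd hd1 =>
    ratioSumIter_eq_ratioSum he _ hd hd1⟩
  set N := ⌊r - d.re⌋₊ + 1 with hNdef
  have hopen : {z : ℂ | r < z.re + N} ∈ 𝓝 d :=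
    (isOpen_lt continuous_const (by fun_prop)).mem_nhds (hN d)
  have hdiff := (differentiableWithinAt_inter hopen).1
    (differentiableOn_ratioSumIter he hr h N d ⟨hd, hN d⟩)
  refine hdiff.congr_of_eventuallyEq ?_ rfl
  filter_upwards [self_mem_nhdsWithin, mem_nhdsWithin_of_mem_nhds hopen] with z hz hzN
  rcases le_total N (⌊r - z.re⌋₊ + 1) with hle | hle
  · exact ratioSumIter_eq_of_le he h hle hz hzN
  · exact (ratioSumIter_eq_of_le he h hle hz (hN z)).symm

theorem excess3F2_two (a b d e : ℂ) : excess3F2 a 2 b d e = d + e - a - b - 2 := by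
  rw [excess3F2]
  ring

theorem isFiniteRatio_of_terminates {a b : ℂ} (h : Terminates3F2 a 2 b) : IsFiniteRatio a b := by
  obtain ⟨m, h | h | h⟩ := h
  · exact ⟨m, Or.inl h⟩
  · exact absurd h (NotNonposInt.of_re_pos (by simp) m)
  · exact ⟨m, Or.inr h⟩

theorem exists_isContinuation3F2_two (a b : ℂ) {e : ℂ} (he : NotNonposInt e) :
    ∃ G : ℂ → ℂ, IsContinuation3F2 a 2 b e fun d =>
      ((d - 1) * (e - 1) + ((a - 1) * (b - 1) - (d - 2) * (e - 2)) * G d) /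
        excess3F2 a 2 b d e := by
  obtain ⟨G, hG, hGs⟩ := exists_continuation_ratioSum a b he
  refine ⟨G, ?_, fun d hd hs => ?_⟩
  · have hG' : DifferentiableOn ℂ G (regular3F2 a 2 b e) :=
      hG.mono fun d hd => mem_ratioSumRegular hd
    refine DifferentiableOn.div (by fun_prop) ?_ fun d hd => hd.2.ne_zero
    simp only [excess3F2_two]
    fun_prop
  · have := hasSum_term3F2_two hd.1 he (Or.inl hs) hd.2.ne_zero
    rwa [← hGs d (mem_ratioSumRegular hd)] at this
    rw [excess3F2_two] at hs
    simp only [Complex.sub_re, Complex.re_ofNat] at hs ⊢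
    linarith

/-- When `(a - 1)(b - 1) = (d - 2)(e - 2)`, the series `₃F₂(a, 2, b; d, e | 1)` telescopes. -/
theorem has3F2Value_of_telescoping {a b d e : ℂ} (h : Admissible3F2 a 2 b d e)
    (hg : (a - 1) * (b - 1) = (d - 2) * (e - 2)) (hs : excess3F2 a 2 b d e ≠ 0) :
    Has3F2Value a 2 b d e ((d - 1) * (e - 1) / excess3F2 a 2 b d e) := by
  obtain ⟨hd, he, hr⟩ := h
  rw [Has3F2Value]
  split_ifs with hc
  · have := hasSum_term3F2_two hd he (hc.imp_right isFiniteRatio_of_terminates) hs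
    rwa [hg, sub_self, zero_mul, add_zero] at this
  · obtain ⟨G, hG⟩ := exists_isContinuation3F2_two a b he
    refine ⟨⟨hd, hr.resolve_left fun ht => hc (Or.inr ht)⟩, _, hG, ?_⟩
    -- The coefficient of `G` vanishes at this `d`, so the unknown value of the continuation drops
    -- out.
    simp only [hg, sub_self, zero_mul, add_zero]

/-! ### Symmetry in the upper parameters, and finite sums -/

theorem term3F2_swap (a b c d e : ℂ) : term3F2 a b c d e = term3F2 b a c d e := by
  ext k
  simp only [term3F2, mul_comm (rising a k)]

theorem excess3F2_swap (a b c d e : ℂ) : excess3F2 a b c d e = excess3F2 b a c d e := by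
  simp only [excess3F2, add_comm a b]

theorem terminates3F2_swap (a b c : ℂ) : Terminates3F2 a b c ↔ Terminates3F2 b a c := by
  simp only [Terminates3F2, or_left_comm]

theorem regular3F2_swap (a b c e : ℂ) : regular3F2 a b c e = regular3F2 b a c e := by
  simp only [regular3F2, excess3F2_swap a b]

theorem isContinuation3F2_swap (a b c e : ℂ) (g : ℂ → ℂ) :
    IsContinuation3F2 a b c e g ↔ IsContinuation3F2 b a c e g := by
  simp only [IsContinuation3F2, regular3F2_swap a b, excess3F2_swap a b, term3F2_swap a b]

theorem has3F2Value_swap (a b c d e v : ℂ) :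
    Has3F2Value a b c d e v ↔ Has3F2Value b a c d e v := by
  have hc : 0 < (excess3F2 a b c d e).re ∨ Terminates3F2 a b c ↔
      0 < (excess3F2 b a c d e).re ∨ Terminates3F2 b a c := by
    rw [excess3F2_swap a b, terminates3F2_swap a b]
  by_cases h : 0 < (excess3F2 a b c d e).re ∨ Terminates3F2 a b c
  · rw [Has3F2Value, Has3F2Value, if_pos h, if_pos (hc.1 h), term3F2_swap]
  · rw [Has3F2Value, Has3F2Value, if_neg h, if_neg (hc.not.1 h), regular3F2_swap]
    simp only [isContinuation3F2_swap a b]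

theorem admissible3F2_swap (a b c d e : ℂ) :
    Admissible3F2 a b c d e ↔ Admissible3F2 b a c d e := by
  simp only [Admissible3F2, excess3F2_swap a b, terminates3F2_swap a b]

/-- The telescoping identity for partial sums, asking only that the denominators up to index `m` be
nonzero. The boundary term carries the factor `b + m`, which vanishes at `b = -m`. -/
theorem excess_mul_sum_range_term3F2_two {a b d e : ℂ}
    (hg : (a - 1) * (b - 1) = (d - 2) * (e - 2)) (m : ℕ)
    (hd : ∀ k < m, d + k ≠ 0) (he : ∀ k < m, e + k ≠ 0) :
    excess3F2 a 2 b d e * ∑ k ∈ Finset.range (m + 1), term3F2 a 2 b d e k =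
      (d - 1) * (e - 1) - (a + m) * (b + m) * risingRatio a b d e m := by
  induction m with
  | zero =>
    simp only [zero_add, Finset.sum_range_one, term3F2_two, risingRatio_zero, Nat.cast_zero,
      excess3F2_two]
    linear_combination hg
  | succ m ih =>
    have h1 := mul_risingRatio_succ a b (hd m m.lt_succ_self) (he m m.lt_succ_self)
    rw [Finset.sum_range_succ, mul_add, ih (fun k hk => hd k (hk.trans m.lt_succ_self))
      fun k hk => he k (hk.trans m.lt_succ_self), term3F2_two, excess3F2_two]
    push_cast
    linear_combination h1 + risingRatio a b d e (m + 1) * hg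

theorem hasSum_term3F2_two_of_finite {a d e : ℂ} (m : ℕ)
    (hg : (a - 1) * (-(m : ℂ) - 1) = (d - 2) * (e - 2))
    (hs : excess3F2 a 2 (-(m : ℂ)) d e ≠ 0)
    (hd : ∀ k < m, d + k ≠ 0) (he : ∀ k < m, e + k ≠ 0) :
    HasSum (term3F2 a 2 (-(m : ℂ)) d e)
      ((d - 1) * (e - 1) / excess3F2 a 2 (-(m : ℂ)) d e) := by
  have h := excess_mul_sum_range_term3F2_two hg m hd he
  rw [neg_add_cancel, mul_zero, zero_mul, sub_zero] at h
  rw [← h, mul_div_cancel_left₀ _ hs]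
  refine hasSum_sum_of_ne_finset_zero fun k hk => ?_
  -- Beyond `m` the numerator is 0, so the term is 0 even where a lower parameter makes the
  -- denominator vanish.
  rw [term3F2, rising_neg_eq_zero (by simpa using hk), mul_zero, zero_div]

/-! ### Lower parameter 4 -/

/-- The rational particular solution of the recurrence for `ratioSum a b 4`. -/
noncomputable def ratioSumFourRational (a b d : ℂ) : ℂ :=
  -6 * (d - 1) * ((d - 2) * (d - 3) + (a - 3) * (b - 3) * (d - 2) +
      (a - 3) * (a - 2) * (b - 3) * (b - 2) / 2) /
    ((a - 1) * (a - 2) * (a - 3) * ((b - 1) * (b - 2) * (b - 3)))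

theorem ratioSumFourRational_recurrence {a b : ℂ} (d : ℂ)
    (h : (a - 1) * (a - 2) * (a - 3) * ((b - 1) * (b - 2) * (b - 3)) ≠ 0) :
    d * (d + 4 - a - b - 1) * ratioSumFourRational a b d =
      d * (4 - 1) + (d - a) * (d - b) * ratioSumFourRational a b (d + 1) := by
  simp only [ratioSumFourRational]
  rw [mul_div_assoc', mul_div_assoc', ← sub_eq_iff_eq_add, div_sub_div_same, div_eq_iff h]
  ring

theorem tendsto_ratioSumFourRational (a b d : ℂ) :
    Tendsto (fun N : ℕ => ratioSumFourRational a b (d + N) / (N : ℂ) ^ 3) atTop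
      (𝓝 (-6 / ((a - 1) * (a - 2) * (a - 3) * ((b - 1) * (b - 2) * (b - 3))))) := by
  -- The cubic divided by `N ^ 3`, rewritten in `u = 1/N`, so that the limit is a value at `u = 0`.
  let φ : ℂ → ℂ := fun u => -6 * (1 + (d - 1) * u) * ((1 + (d - 2) * u) * (1 + (d - 3) * u) +
      (a - 3) * (b - 3) * u * (1 + (d - 2) * u) +
      (a - 3) * (a - 2) * (b - 3) * (b - 2) / 2 * u ^ 2) /
    ((a - 1) * (a - 2) * (a - 3) * ((b - 1) * (b - 2) * (b - 3)))
  have hφ : Continuous φ := by fun_prop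
  have h := (hφ.tendsto 0).comp (tendsto_inv_atTop_nhds_zero_nat (𝕜 := ℂ))
  have h0 : φ 0 = -6 / ((a - 1) * (a - 2) * (a - 3) * ((b - 1) * (b - 2) * (b - 3))) := by
    simp [φ]
  rw [h0] at h
  refine h.congr' ?_
  filter_upwards [eventually_ne_atTop 0] with N hN
  have hN' : (N : ℂ) ≠ 0 := Nat.cast_ne_zero.2 hN
  simp only [Function.comp_apply, φ, ratioSumFourRational]
  rw [div_right_comm]
  congr 1
  field_simp
  ring

theorem tendsto_ratioSum_div {a b e : ℂ} (he : NotNonposInt e) (d : ℂ) :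
    Tendsto (fun N : ℕ => ratioSum a b e (d + N) / (N : ℂ) ^ 3) atTop (𝓝 0) := by
  obtain ⟨r, hr, h⟩ := exists_summable_abscissa a b e
  have hs := summable_norm_risingRatio he hr h
  refine squeeze_zero_norm' (a := fun N : ℕ => (∑' k, ‖risingRatio a b r e k‖) / (N : ℝ) ^ 3) ?_ ?_
  · have h1 : Tendsto (fun N : ℕ => (N : ℝ) + d.re) atTop atTop :=
      tendsto_atTop_add_const_right _ _ tendsto_natCast_atTop_atTop
    filter_upwards [h1.eventually_ge_atTop r] with N hN
    have hb := norm_risingRatio_le a b e hr (d := d + N)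
      (by simp only [Complex.add_re, Complex.natCast_re]; linarith)
    rw [norm_div, norm_pow, Complex.norm_natCast]
    gcongr
    exact tsum_of_norm_bounded hs.hasSum hb
  · exact ((tendsto_pow_atTop (by norm_num)).comp
      tendsto_natCast_atTop_atTop).const_div_atTop _

/-- The difference from the rational solution obeys the homogeneous recurrence. Iterating it `N`
times multiplies by a ratio decaying like `N ^ -3`, while the difference at `d + N` is asymptotic to
`6 N ^ 3 / D`, since the series stays bounded. The limit of the product is the Gamma term. -/
theorem ratioSum_four {a b d : ℂ} (hd : d ∈ ratioSumRegular a b 4)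
    (h : 1 < (d + 4 - a - b).re ∨ IsFiniteRatio a b)
    (hD : (a - 1) * (a - 2) * (a - 3) * ((b - 1) * (b - 2) * (b - 3)) ≠ 0) :
    ratioSum a b 4 d = ratioSumFourRational a b d +
      6 / ((a - 1) * (a - 2) * (a - 3) * ((b - 1) * (b - 2) * (b - 3))) *
        (Complex.Gamma d * Complex.Gamma (d + 4 - a - b - 1) /
          (Complex.Gamma (d - a) * Complex.Gamma (d - b))) := by
  have he : NotNonposInt 4 := NotNonposInt.of_re_pos (by simp)
  have hiter (N : ℕ) : ratioSum a b 4 d - ratioSumFourRational a b d =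
      (ratioSum a b 4 (d + N) - ratioSumFourRational a b (d + N)) *
        risingRatio (d - a) (d - b) d (d + 4 - a - b - 1) N := by
    induction N with
    | zero => simp [risingRatio_zero]
    | succ N ih =>
      have h1 := hd.1.add_natCast_ne_zero N
      have h2 := hd.2.add_natCast_ne_zero N
      have h3 := ratioSum_recurrence (a := a) (b := b) (hd.1.add_natCast N) he
        (h.imp_left fun h => by
          simp only [Complex.add_re, Complex.sub_re, Complex.natCast_re] at h ⊢
          linarith [(Nat.cast_nonneg N : (0 : ℝ) ≤ N)])
      have h4 := ratioSumFourRational_recurrence (d + N) hD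
      rw [ih, risingRatio_succ, mul_left_comm, mul_comm (_ - _) (risingRatio _ _ _ _ _)]
      congr 1
      rw [mul_div_assoc', eq_div_iff (mul_ne_zero h1 h2)]
      push_cast
      rw [← add_assoc]
      linear_combination h3 - h4
  have hlim := ((tendsto_ratioSum_div (a := a) (b := b) he d).sub
    (tendsto_ratioSumFourRational a b d)).mul (tendsto_risingRatio (d - a) (d - b) hd.1 hd.2)
  have hconst : Tendsto (fun _ : ℕ => ratioSum a b 4 d - ratioSumFourRational a b d) atTop
      (𝓝 (ratioSum a b 4 d - ratioSumFourRational a b d)) := tendsto_const_nhds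
  have huniq := tendsto_nhds_unique (hconst.congr' ?_) hlim
  · linear_combination huniq
  · filter_upwards [eventually_ne_atTop 0] with N hN
    have hN' : (N : ℂ) ≠ 0 := Nat.cast_ne_zero.2 hN
    have hexp : d + (d + 4 - a - b - 1) - (d - a) - (d - b) = (3 : ℕ) := by
      push_cast
      ring
    rw [hiter N, hexp, Complex.cpow_natCast]
    field_simp

theorem hasSum_term3F2_two_four {a b c : ℂ} (hc : c ∈ regular3F2 a 2 b 4)
    (h : 0 < (excess3F2 a 2 b c 4).re ∨ IsFiniteRatio a b)
    (ha1 : a ≠ 1) (ha2 : a ≠ 2) (ha3 : a ≠ 3) (hb1 : b ≠ 1) (hb2 : b ≠ 2) (hb3 : b ≠ 3) :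
    HasSum (term3F2 a 2 b c 4)
      (-6 * ((2 * c - 5 + b - a * b + a) * Complex.Gamma c * Complex.Gamma (-b + 2 + c - a)) /
          ((a - 3) * (b - 1) * (-2 + a) * (a - 1) * (b - 3) * (b - 2) *
            Complex.Gamma (c - a) * Complex.Gamma (c - b)) +
        6 * (c - 2) * (c - 1) * (a * b - 3 * b - 3 * a + 3 + 2 * c) /
          ((a - 3) * (b - 1) * (-2 + a) * (a - 1) * (b - 3) * (b - 2))) := by
  have hD : (a - 1) * (a - 2) * (a - 3) * ((b - 1) * (b - 2) * (b - 3)) ≠ 0 := by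
    simp [sub_eq_zero, *]
  have hs : c + 4 - a - b - 2 ≠ 0 := by rw [← excess3F2_two]; exact hc.2.ne_zero
  have hS := ratioSum_four (mem_ratioSumRegular hc) (h.imp_left fun h => by
    rw [excess3F2_two] at h
    simp only [Complex.sub_re, Complex.re_ofNat] at h ⊢
    linarith) hD
  -- The argument is the excess plus one, so the functional equation yields the factor that cancels
  -- the division by the excess.
  have hG : Complex.Gamma (c + 4 - a - b - 1) =
      (c + 4 - a - b - 2) * Complex.Gamma (-b + 2 + c - a) := by
    have := Complex.Gamma_add_one _ hs
    ring_nf at this ⊢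
    exact this
  have hD' : (a - 3) * (b - 1) * (-2 + a) * (a - 1) * (b - 3) * (b - 2) =
      (a - 1) * (a - 2) * (a - 3) * ((b - 1) * (b - 2) * (b - 3)) := by ring
  have hF := hasSum_term3F2_two hc.1 (NotNonposInt.of_re_pos (by simp)) h hc.2.ne_zero
  convert hF using 1
  rw [hS, hG, hD', excess3F2_two, ratioSumFourRational,
    eq_div_iff hs, mul_assoc _ (Complex.Gamma (c - a))]
  simp only [div_eq_mul_inv, mul_inv]
  set X := (Complex.Gamma (c - a))⁻¹ * (Complex.Gamma (c - b))⁻¹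
  have hDi := mul_inv_cancel₀ hD
  simp only [mul_inv] at hDi
  linear_combination (c - 1) * (4 - 1) * hDi

theorem has3F2Value_two_four {a b c : ℂ} (hc : NotNonposInt c)
    (hs : NotNonposInt (-b + 2 + c - a))
    (ha1 : a ≠ 1) (ha2 : a ≠ 2) (ha3 : a ≠ 3) (hb1 : b ≠ 1) (hb2 : b ≠ 2) (hb3 : b ≠ 3) :
    Has3F2Value a 2 b c 4
      (-6 * ((2 * c - 5 + b - a * b + a) * Complex.Gamma c * Complex.Gamma (-b + 2 + c - a)) /
          ((a - 3) * (b - 1) * (-2 + a) * (a - 1) * (b - 3) * (b - 2) *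
            Complex.Gamma (c - a) * Complex.Gamma (c - b)) +
        6 * (c - 2) * (c - 1) * (a * b - 3 * b - 3 * a + 3 + 2 * c) /
          ((a - 3) * (b - 1) * (-2 + a) * (a - 1) * (b - 3) * (b - 2))) := by
  have hexc (d : ℂ) : excess3F2 a 2 b d 4 = -b + 2 + d - a := by rw [excess3F2]; ring
  have hreg : c ∈ regular3F2 a 2 b 4 := ⟨hc, by rwa [hexc]⟩
  rw [Has3F2Value]
  split_ifs with h
  · exact hasSum_term3F2_two_four hreg (h.imp_right isFiniteRatio_of_terminates)
      ha1 ha2 ha3 hb1 hb2 hb3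
  -- The closed form is its own continuation: both Gamma factors in the numerator are regular here,
  -- and `1/Γ` is entire.
  · refine ⟨hreg, fun c =>
      -6 * ((2 * c - 5 + b - a * b + a) * Complex.Gamma c * Complex.Gamma (-b + 2 + c - a)) /
          ((a - 3) * (b - 1) * (-2 + a) * (a - 1) * (b - 3) * (b - 2) *
            Complex.Gamma (c - a) * Complex.Gamma (c - b)) +
        6 * (c - 2) * (c - 1) * (a * b - 3 * b - 3 * a + 3 + 2 * c) /
          ((a - 3) * (b - 1) * (-2 + a) * (a - 1) * (b - 3) * (b - 2)),
      ⟨fun d hd => DifferentiableAt.differentiableWithinAt ?_, fun d hd hpos =>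
        hasSum_term3F2_two_four hd (Or.inl hpos) ha1 ha2 ha3 hb1 hb2 hb3⟩, rfl⟩
    have h1 := Complex.differentiableAt_Gamma d hd.1
    have h2 : DifferentiableAt ℂ (fun d => Complex.Gamma (-b + 2 + d - a)) d :=
      DifferentiableAt.comp (g := Complex.Gamma) d
        (Complex.differentiableAt_Gamma _ (by rw [← hexc]; exact hd.2)) (by fun_prop)
    have h3 (z : ℂ) : DifferentiableAt ℂ (fun d => (Complex.Gamma (d - z))⁻¹) d :=
      DifferentiableAt.comp (g := fun s => (Complex.Gamma s)⁻¹) d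
        (Complex.differentiable_one_div_Gamma _) (by fun_prop)
    have h4 := h3 a
    have h5 := h3 b
    simp only [div_eq_mul_inv, mul_inv]
    fun_prop

/-! ### Excess two -/

theorem hasSum_term3F2_two_of_excess_two {a b c : ℂ} (hc : NotNonposInt c)
    (he : NotNonposInt (4 + a - c + b))
    (ha1 : c ≠ a + 1) (ha2 : c ≠ a + 2) (ha3 : c ≠ a + 3)
    (hb1 : c ≠ b + 1) (hb2 : c ≠ b + 2) (hb3 : c ≠ b + 3) :
    HasSum (term3F2 a 2 b c (4 + a - c + b))
      ((-a - 2 + c - b) * (-a - 3 + c - b) * (c - 2) * (c - 1) *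
              (3 - 4 * c - c * a + c ^ 2 + 3 * a + a * b + 3 * b - b * c) /
            ((-a - 2 + c) * (c - 3 - b) * (c - 2 - b) * (c - 1 - b) * (-a - 3 + c) *
              (-a + c - 1)) +
          (a + 5 - c * a + c ^ 2 - 4 * c + a * b - b * c + b) *
              Complex.Gamma (4 + a - c + b) * Complex.Gamma c /
            ((-a - 2 + c) * (c - 3 - b) * (c - 2 - b) * (c - 1 - b) * (-a - 3 + c) *
              (-a + c - 1) * Complex.Gamma b * Complex.Gamma a)) := by
  set E := (-a - 2 + c) * (c - 3 - b) * (c - 2 - b) * (c - 1 - b) * (-a - 3 + c) * (-a + c - 1)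
    with hEdef
  have hE : E ≠ 0 := by
    have h1 : -a - 2 + c ≠ 0 := fun h => ha2 (by linear_combination h)
    have h2 : c - 3 - b ≠ 0 := fun h => hb3 (by linear_combination h)
    have h3 : c - 2 - b ≠ 0 := fun h => hb2 (by linear_combination h)
    have h4 : c - 1 - b ≠ 0 := fun h => hb1 (by linear_combination h)
    have h5 : -a - 3 + c ≠ 0 := fun h => ha3 (by linear_combination h)
    have h6 : -a + c - 1 ≠ 0 := fun h => ha1 (by linear_combination h)
    simp only [hEdef]
    positivity
  set e := 4 + a - c + b with hedef
  have hw : c + e - a - b = (4 : ℕ) := by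
    rw [hedef]
    push_cast
    ring
  have hw' : (c + e - a - b).re = 4 := by rw [hw]; simp
  have s0 := summable_pow_mul_risingRatio (a := a) (b := b) hc he 0 (by left; norm_num [hw'])
  have s1 := summable_pow_mul_risingRatio (a := a) (b := b) hc he 1 (by left; norm_num [hw'])
  have t0 := tendsto_pow_mul_risingRatio (a := a) (b := b) hc he 0 (by left; norm_num [hw'])
  have t1 := tendsto_pow_mul_risingRatio (a := a) (b := b) hc he 1 (by left; norm_num [hw'])
  have t2 := tendsto_pow_mul_risingRatio (a := a) (b := b) hc he 2 (by left; norm_num [hw'])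
  have t3 := tendsto_pow_mul_risingRatio (a := a) (b := b) hc he 3 (by left; norm_num [hw'])
  have t4 := tendsto_risingRatio a b hc he
  simp only [hw, Complex.cpow_natCast] at t4
  have hsum : Summable (term3F2 a 2 b c e) := by
    refine (s1.add s0).congr fun k => ?_
    rw [term3F2_two]
    ring
  -- Coefficients of the Gosper certificate `x k² + y k + z`. With excess 2 the `k⁴` and `k³`
  -- coefficients in `key` cancel identically. The `k²` coefficient gives `y` in terms of `x`, and
  -- the remaining two must equal `E`. The names are kept opaque until `ring` needs them.
  obtain ⟨x, hx⟩ : ∃ x, x = a + 5 - c * a + c ^ 2 - 4 * c + a * b - b * c + b := ⟨_, rfl⟩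
  obtain ⟨y, hy⟩ : ∃ y, y = x * (x - 1 + 2 * (a + b)) := ⟨_, rfl⟩
  obtain ⟨z, hz⟩ : ∃ z, z = (c - a - b - 2) * (c - 2) *
    (3 - 4 * c - c * a + c ^ 2 + 3 * a + a * b + 3 * b - b * c) := ⟨_, rfl⟩
  -- The ratio decays like `k ^ -4`, so only the quartic coefficient `x / E` survives, multiplied by
  -- the Gamma quotient.
  have hU : Tendsto (fun k : ℕ => (x * k ^ 2 + y * k + z) / E * ((c + k - 1) * (e + k - 1)) *
      risingRatio a b c e k) atTop (𝓝 (x / E * (Complex.Gamma c * Complex.Gamma e /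
        (Complex.Gamma a * Complex.Gamma b)))) := by
    have := ((((t4.const_mul (x / E)).add
      (t3.const_mul ((y + x * (c + e - 2)) / E))).add
      (t2.const_mul ((z + y * (c + e - 2) + x * ((c - 1) * (e - 1))) / E))).add
      (t1.const_mul ((z * (c + e - 2) + y * ((c - 1) * (e - 1))) / E))).add
      (t0.const_mul (z * ((c - 1) * (e - 1)) / E))
    simp only [mul_zero, add_zero] at this
    refine this.congr fun k => ?_
    ring
  have ht := hsum.hasSum_of_telescoping (fun k => ?_) hU
  · convert ht using 1
    simp only [risingRatio_zero, Nat.cast_zero]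
    simp only [div_eq_mul_inv, mul_inv, hz, hx, hedef]
    ring
  · have h1 := mul_risingRatio_succ a b (hc.add_natCast_ne_zero k) (he.add_natCast_ne_zero k)
    have key : (x * (k + 1) ^ 2 + y * (k + 1) + z) * ((a + k) * (b + k)) -
        (x * k ^ 2 + y * k + z) * ((c + k - 1) * (e + k - 1)) = (k + 1) * E := by
      rw [hy, hz, hx, hEdef, hedef]
      ring
    rw [term3F2_two]
    push_cast
    apply mul_left_cancel₀ hE
    field_simp
    linear_combination risingRatio a b c e k * key +
      (x * (k + 1) ^ 2 + y * (k + 1) + z) * h1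

/-! ### The telescoping families -/

theorem has3F2Value_two_one_sub {a b : ℂ} {n : ℕ} (hn : 1 ≤ n) (hb : b ≠ 2)
    (hab : 1 + a - b ≠ 0) (hbn : b + n - 2 ≠ 0)
    (h : ∀ k : ℕ, k + 1 < n → b ≠ -(k : ℂ) ∧ 2 + n * (-a + 1) / (b - 2) ≠ -(k : ℂ)) :
    Has3F2Value 2 a (1 - n) b (2 + n * (-a + 1) / (b - 2))
      ((a * n - b - n + 2) * (b - 1) / ((1 + a - b) * (b + n - 2))) := by
  obtain ⟨m, rfl⟩ := Nat.exists_eq_add_of_le' hn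
  have hm : (1 : ℂ) - (m + 1 : ℕ) = -(m : ℂ) := by push_cast; ring
  have hb' : b - 2 ≠ 0 := sub_ne_zero.2 hb
  have hs : excess3F2 a 2 (-(m : ℂ)) b (2 + (m + 1 : ℕ) * (-a + 1) / (b - 2)) =
      -((1 + a - b) * (b + (m + 1 : ℕ) - 2)) / (b - 2) := by
    rw [excess3F2_two]
    field_simp
    push_cast
    ring
  have hs0 : excess3F2 a 2 (-(m : ℂ)) b (2 + (m + 1 : ℕ) * (-a + 1) / (b - 2)) ≠ 0 := by
    rw [hs]
    exact div_ne_zero (neg_ne_zero.2 (mul_ne_zero hab hbn)) hb'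
  rw [has3F2Value_swap, hm, Has3F2Value, if_pos (Or.inr ⟨m, Or.inr (Or.inr rfl)⟩)]
  have key := hasSum_term3F2_two_of_finite m (a := a) (d := b)
    (e := 2 + (m + 1 : ℕ) * (-a + 1) / (b - 2)) ?_ hs0
    (fun k hk hz => (h k (by lia)).1 (eq_neg_of_add_eq_zero_left hz))
    (fun k hk hz => (h k (by lia)).2 (eq_neg_of_add_eq_zero_left hz))
  · convert key using 1
    rw [hs]
    field_simp
    ring
  · field_simp
    push_cast
    ring

theorem has3F2Value_two_add_one_add {a b : ℂ} {n : ℕ} (hn : 1 ≤ n) (han : a + n - 1 ≠ 0)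
    (hab : n - b + a ≠ 0)
    (h : Admissible3F2 a 2 b (1 + (b * (a - 1) + n) / (a + n - 1)) (1 + a + n)) :
    Has3F2Value a 2 b (1 + (b * (a - 1) + n) / (a + n - 1)) (1 + a + n)
      ((n + a * b - b) * (a + n) / ((n - b + a) * n)) := by
  have hn0 : (n : ℂ) ≠ 0 := Nat.cast_ne_zero.2 (by lia)
  have hs : excess3F2 a 2 b (1 + (b * (a - 1) + n) / (a + n - 1)) (1 + a + n) =
      (n - b + a) * n / (a + n - 1) := by
    rw [excess3F2_two]
    field_simp
    ring
  have key := has3F2Value_of_telescoping h ?_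
    (by rw [hs]; exact div_ne_zero (mul_ne_zero hab hn0) han)
  · convert key using 1
    rw [hs]
    field_simp
    ring
  · field_simp
    ring

theorem has3F2Value_two_natCast_add_one {a b : ℂ} {n : ℕ} (hb : b ≠ 2)
    (hab : 1 + a - b ≠ 0) (hbn : n + 2 - b ≠ 0)
    (h : Admissible3F2 2 a (n + 1) b (2 + n * (a - 1) / (b - 2))) :
    Has3F2Value 2 a (n + 1) b (2 + n * (a - 1) / (b - 2))
      ((a * n + b - 2 - n) * (b - 1) / ((1 + a - b) * (n + 2 - b))) := by
  have hb' : b - 2 ≠ 0 := sub_ne_zero.2 hb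
  have hs : excess3F2 a 2 (n + 1) b (2 + n * (a - 1) / (b - 2)) =
      (1 + a - b) * (n + 2 - b) / (b - 2) := by
    rw [excess3F2_two]
    field_simp
    ring
  rw [admissible3F2_swap] at h
  rw [has3F2Value_swap]
  have key := has3F2Value_of_telescoping h ?_
    (by rw [hs]; exact div_ne_zero (mul_ne_zero hab hbn) hb')
  · convert key using 1
    rw [hs]
    field_simp
    ring
  · field_simp
    ring

/-- The two arguments differ by `(n + 1) π`, so the sine quotient in (5), with its sign, equals 1.
-/
theorem sin_pi_mul_div_eq {a b : ℂ} (n : ℕ) (hb : b ≠ 2) :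
    Complex.sin (Real.pi * ((n + 2 - b) * (1 + a - b) / (b - 2))) =
      -((-1) ^ n * Complex.sin (Real.pi * (b - a + n * (a - 1) / (b - 2)))) := by
  have hb' : b - 2 ≠ 0 := sub_ne_zero.2 hb
  have harg : (Real.pi : ℂ) * ((n + 2 - b) * (1 + a - b) / (b - 2)) =
      Real.pi * (b - a + n * (a - 1) / (b - 2)) - ((n + 1 : ℕ) : ℂ) * Real.pi := by
    field_simp
    push_cast
    ring
  rw [harg, Complex.sin_antiperiodic.sub_nat_mul_eq, pow_succ]
  ring

theorem has3F2Value_two_sub_add_one {a b : ℂ} {n : ℕ} (hn : 1 ≤ n) (han : a - n - 1 ≠ 0)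
    (hab : b - a + n ≠ 0)
    (h : Admissible3F2 a 2 b (2 + (b - 1) * (a - 1) / (a - n - 1)) (a - n + 1)) :
    Has3F2Value a 2 b (2 + (b - 1) * (a - 1) / (a - n - 1)) (a - n + 1)
      ((n - a) * (n - a * b + b) / ((b - a + n) * n)) := by
  have hn0 : (n : ℂ) ≠ 0 := Nat.cast_ne_zero.2 (by lia)
  have hs : excess3F2 a 2 b (2 + (b - 1) * (a - 1) / (a - n - 1)) (a - n + 1) =
      (b - a + n) * n / (a - n - 1) := by
    rw [excess3F2_two]
    field_simp
    ring
  have key := has3F2Value_of_telescoping h ?_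
    (by rw [hs]; exact div_ne_zero (mul_ne_zero hab hn0) han)
  · convert key using 1
    rw [hs]
    field_simp
    ring
  · field_simp
    ring

/-! ### Assembly of the six evaluations -/

theorem mainTheorem11 :
    -- upper parameters `a, 2, b`, lower parameters `c, 4`
    (∀ a b c : ℂ, NotNonposInt c → NotNonposInt (-b + 2 + c - a) →
      a ≠ 1 → a ≠ 2 → a ≠ 3 → b ≠ 1 → b ≠ 2 → b ≠ 3 →
      Has3F2Value a 2 b c 4
        (-6 * ((2 * c - 5 + b - a * b + a) * Complex.Gamma c * Complex.Gamma (-b + 2 + c - a)) /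
            ((a - 3) * (b - 1) * (-2 + a) * (a - 1) * (b - 3) * (b - 2) *
              Complex.Gamma (c - a) * Complex.Gamma (c - b)) +
          6 * (c - 2) * (c - 1) * (a * b - 3 * b - 3 * a + 3 + 2 * c) /
            ((a - 3) * (b - 1) * (-2 + a) * (a - 1) * (b - 3) * (b - 2)))) ∧
    -- upper parameters `a, 2, b`, lower parameters `c, 4 + a - c + b`
    (∀ a b c : ℂ, NotNonposInt c → NotNonposInt (4 + a - c + b) →
      c ≠ a + 1 → c ≠ a + 2 → c ≠ a + 3 → c ≠ b + 1 → c ≠ b + 2 → c ≠ b + 3 →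
      Has3F2Value a 2 b c (4 + a - c + b)
        ((-a - 2 + c - b) * (-a - 3 + c - b) * (c - 2) * (c - 1) *
              (3 - 4 * c - c * a + c ^ 2 + 3 * a + a * b + 3 * b - b * c) /
            ((-a - 2 + c) * (c - 3 - b) * (c - 2 - b) * (c - 1 - b) * (-a - 3 + c) *
              (-a + c - 1)) +
          (a + 5 - c * a + c ^ 2 - 4 * c + a * b - b * c + b) *
              Complex.Gamma (4 + a - c + b) * Complex.Gamma c /
            ((-a - 2 + c) * (c - 3 - b) * (c - 2 - b) * (c - 1 - b) * (-a - 3 + c) *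
              (-a + c - 1) * Complex.Gamma b * Complex.Gamma a))) ∧
    -- upper parameters `2, a, 1 - n`, lower parameters `b, 2 + n (1 - a) / (b - 2)`
    (∀ (n : ℕ) (a b : ℂ), 1 ≤ n → b ≠ 2 → 1 + a - b ≠ 0 → b + n - 2 ≠ 0 →
      (∀ k : ℕ, k + 1 < n → b ≠ -(k : ℂ) ∧ 2 + n * (-a + 1) / (b - 2) ≠ -(k : ℂ)) →
      Has3F2Value 2 a (1 - n) b (2 + n * (-a + 1) / (b - 2))
        ((a * n - b - n + 2) * (b - 1) / ((1 + a - b) * (b + n - 2)))) ∧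
    -- upper parameters `a, 2, b`, lower parameters `1 + (b (a - 1) + n) / (a + n - 1), 1 + a + n`
    (∀ (n : ℕ) (a b : ℂ), 1 ≤ n → a + n - 1 ≠ 0 → n - b + a ≠ 0 →
      Admissible3F2 a 2 b (1 + (b * (a - 1) + n) / (a + n - 1)) (1 + a + n) →
      Has3F2Value a 2 b (1 + (b * (a - 1) + n) / (a + n - 1)) (1 + a + n)
        ((n + a * b - b) * (a + n) / ((n - b + a) * n))) ∧
    -- upper parameters `2, a, n + 1`, lower parameters `b, 2 + n (a - 1) / (b - 2)`
    (∀ (n : ℕ) (a b : ℂ), 1 ≤ n → b ≠ 2 → 1 + a - b ≠ 0 → n + 2 - b ≠ 0 →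
      Admissible3F2 2 a (n + 1) b (2 + n * (a - 1) / (b - 2)) →
      Has3F2Value 2 a (n + 1) b (2 + n * (a - 1) / (b - 2))
        ((a * n + b - 2 - n) * (b - 1) / ((1 + a - b) * (n + 2 - b))) ∧
      (Complex.sin (Real.pi * ((n + 2 - b) * (1 + a - b) / (b - 2))) ≠ 0 →
        Has3F2Value 2 a (n + 1) b (2 + n * (a - 1) / (b - 2))
          (-((-1) ^ n * Complex.sin (Real.pi * (b - a + n * (a - 1) / (b - 2))) *
              (a * n + b - 2 - n) * (b - 1) /
            ((1 + a - b) * (n + 2 - b) *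
              Complex.sin (Real.pi * ((n + 2 - b) * (1 + a - b) / (b - 2)))))))) ∧
    -- upper parameters `a, 2, b`, lower parameters `2 + (b-1)(a-1)/(a-n-1), a - n + 1`
    (∀ (n : ℕ) (a b : ℂ), 1 ≤ n → a - n - 1 ≠ 0 → b - a + n ≠ 0 →
      Admissible3F2 a 2 b (2 + (b - 1) * (a - 1) / (a - n - 1)) (a - n + 1) →
      Has3F2Value a 2 b (2 + (b - 1) * (a - 1) / (a - n - 1)) (a - n + 1)
        ((n - a) * (n - a * b + b) / ((b - a + n) * n))) := by
  refine ⟨fun a b c hc hs ha1 ha2 ha3 hb1 hb2 hb3 =>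
      has3F2Value_two_four hc hs ha1 ha2 ha3 hb1 hb2 hb3,
    fun a b c hc he ha1 ha2 ha3 hb1 hb2 hb3 => ?_,
    fun n a b hn hb hab hbn h => has3F2Value_two_one_sub hn hb hab hbn h,
    fun n a b hn han hab h => has3F2Value_two_add_one_add hn han hab h,
    fun n a b hn hb hab hbn h => ?_,
    fun n a b hn han hab h => has3F2Value_two_sub_add_one hn han hab h⟩
  -- The excess is identically 2, so the series always converges and no continuation is involved.
  · have hexc : 0 < (excess3F2 a 2 b c (4 + a - c + b)).re := by
      have : excess3F2 a 2 b c (4 + a - c + b) = 2 := by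
        rw [excess3F2_two]
        ring
      simp [this]
    rw [Has3F2Value, if_pos (Or.inl hexc)]
    exact hasSum_term3F2_two_of_excess_two hc he ha1 ha2 ha3 hb1 hb2 hb3
  · have hv := has3F2Value_two_natCast_add_one hb hab hbn h
    refine ⟨hv, fun hsin => ?_⟩
    convert hv using 1
    have hsc := sin_pi_mul_div_eq (a := a) n hb
    rw [neg_eq_iff_eq_neg, ← neg_div,
      div_eq_div_iff (mul_ne_zero (mul_ne_zero hab hbn) hsin) (mul_ne_zero hab hbn), hsc]
    ring
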